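/- **Theorem (unilateral Liouville property).** Let $n\ge 1$ and let $a=(a_1,\dots,a_n)\in\mathbb R^n$ satisfy $a_i\ge 0$ for all $i$ and $a_j>0$ for at least one $j$. For a real symmetric $n\times n$ matrix $X$ with eigenvalues $\lambda_1(X)\le\dots\le\lambda_n(X)$ (counted with multiplicity) put $$\mathcal M_a(X)=\sum_{i=1}^n a_i\lambda_i(X),\qquad \hat a_j=(a_1+\dots+a_n)-a_j .$$ Let $\mathcal O\subseteq\mathbb R^n$ be open. A viscosity subsolution of $\mathcal M_a(D^2u)=0$ in $\mathcal O$ is an upper semicontinuous function $u:\mathcal O\to\mathbb R$ such that $\mathcal M_a(X)\ge 0$ whenever $x_0\in\mathcal O$, $\xi\in\mathbb R^n$ and the symmetric matrix $X$ satisfy $$u(x)\le u(x_0)+\langle\xi,x-x_0\rangle+\tfrac12\langle X(x-x_0),x-x_0\rangle+o(|x-x_0|^2)\quad\text{as }x\to x_0 .$$ A viscosity supersolution is a lower semicontinuous function $u:\mathcal O\to\mathbb R$ such that $\mathcal M_a(X)\le 0$ whenever the same holds with $\ge$ in place of $\le$. Then: 1. If $a_1=\hat a_1$ (for instance $\mathcal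 M_a=\lambda_1+\lambda_n$ with $n\ge 2$), every viscosity subsolution of $\mathcal M_a(D^2u)=0$ in $\mathbb R^n\setminus\{0\}$ that is bounded above is constant. 2. If $a_1>\hat a_1$, every viscosity subsolution of $\mathcal M_a(D^2u)=0$ in $\mathbb R^n$ that is bounded above is constant. 3. If $a_n=\hat a_n$, every viscosity supersolution of $\mathcal M_a(D^2v)=0$ in $\mathbb R^n\setminus\{0\}$ that is bounded below is constant. 4. If $a_n>\hat a_n$, every viscosity supersolution of $\mathcal M_a(D^2v)=0$ in $\mathbb R^n$ that is bounded below is constant. -/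

import Mathlib

open Filter Topology Asymptotics

noncomputable section

namespace WeightedTrace

/-- Euclidean space `ℝⁿ`. -/
abbrev Euc (n : ℕ) : Type := EuclideanSpace ℝ (Fin n)

/-- The real symmetric `n × n` matrices (over `ℝ`, Hermitian means symmetric). -/
abbrev SymMat (n : ℕ) : Type := {X : Matrix (Fin n) (Fin n) ℝ // X.IsHermitian}

/-- The eigenvalues of a symmetric matrix, counted with multiplicity and listed in
nondecreasing order. (Mathlib's `eigenvalues₀` lists them in nonincreasing order, hence the
reversal.) -/
def eig {n : ℕ} (X : SymMat n) (i : Fin n) : ℝ :=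
  X.2.eigenvalues₀ (Fin.cast (Fintype.card_fin n).symm i.rev)

/-- The weighted partial trace operator `X ↦ ∑ i, a i * λ i (X)`. -/
def weightedTrace {n : ℕ} (a : Fin n → ℝ) (X : SymMat n) : ℝ :=
  ∑ i, a i * eig X i

/-- The admissible weights: nonnegative, and not all zero. -/
def AdmissibleWeights {n : ℕ} (a : Fin n → ℝ) : Prop :=
  (∀ i, 0 ≤ a i) ∧ ∃ i, 0 < a i

/-- The complementary weight: the sum of all the weights, minus the `j`-th one. -/
def complWeight {n : ℕ} (a : Fin n → ℝ) (j : Fin n) : ℝ :=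
  (∑ i, a i) - a j

/-- The quadratic polynomial `c + ⟨ξ, x - x₀⟩ + ½ ⟨X (x - x₀), x - x₀⟩`. -/
def quadPoly {n : ℕ} (c : ℝ) (ξ : Euc n) (X : SymMat n) (x₀ x : Euc n) : ℝ :=
  c + inner ℝ ξ (x - x₀)
    + (1 / 2) * inner ℝ (Matrix.toEuclideanLin X.1 (x - x₀)) (x - x₀)

/-- The second order superjet of `u` at `x₀` relative to `O`: the pairs `(ξ, X)` such that
`u x ≤ u x₀ + ⟨ξ, x - x₀⟩ + ½ ⟨X (x - x₀), x - x₀⟩ + o(|x - x₀|²)` as `x → x₀` in `O`. -/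
def superjet {n : ℕ} (O : Set (Euc n)) (u : Euc n → ℝ) (x₀ : Euc n) :
    Set (Euc n × SymMat n) :=
  {p | ∃ ρ : Euc n → ℝ, ρ =o[𝓝[O] x₀] (fun x => ‖x - x₀‖ ^ 2) ∧
    ∀ᶠ x in 𝓝[O] x₀, u x ≤ quadPoly (u x₀) p.1 p.2 x₀ x + ρ x}

/-- The second order subjet of `u` at `x₀` relative to `O`. -/
def subjet {n : ℕ} (O : Set (Euc n)) (u : Euc n → ℝ) (x₀ : Euc n) :
    Set (Euc n × SymMat n) :=
  {p | ∃ ρ : Euc n → ℝ, ρ =o[𝓝[O] x₀] (fun x => ‖x - x₀‖ ^ 2) ∧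
    ∀ᶠ x in 𝓝[O] x₀, quadPoly (u x₀) p.1 p.2 x₀ x + ρ x ≤ u x}

/-- `u` is a viscosity subsolution of `F(D²u) = f` in `O`. Only the values of `u` on `O`
matter. -/
def IsViscositySubsolution {n : ℕ} (F : SymMat n → ℝ) (f : Euc n → ℝ) (O : Set (Euc n))
    (u : Euc n → ℝ) : Prop :=
  UpperSemicontinuousOn u O ∧
    ∀ x ∈ O, ∀ ξ : Euc n, ∀ X : SymMat n, (ξ, X) ∈ superjet O u x → f x ≤ F X

/-- `u` is a viscosity supersolution of `F(D²u) = f` in `O`. Only the values of `u` on `O`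
matter. -/
def IsViscositySupersolution {n : ℕ} (F : SymMat n → ℝ) (f : Euc n → ℝ) (O : Set (Euc n))
    (u : Euc n → ℝ) : Prop :=
  LowerSemicontinuousOn u O ∧
    ∀ x ∈ O, ∀ ξ : Euc n, ∀ X : SymMat n, (ξ, X) ∈ subjet O u x → F X ≤ f x

end WeightedTrace

end

noncomputable section

namespace WeightedTrace

variable {n : ℕ}

/-! For a unit vector `e` and an upper bound `C` of the quadratic form of `X`, the weighted trace is
at most `α ⟨X e, e⟩ + β C`, with `α` the first weight and `β` its complement (`weightedTrace_le`).
So a subsolution satisfies an inequality in `α, β` alone; for a supersolution `v`, `-v` satisfies it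
with the last weight. Thus claims 3 and 4 reduce to the proofs of 1 and 2.

The inequality gives comparison with strict radial barriers `g (‖x - y‖ ^ 2)` on annuli
(`le_of_le_sphere`). If `β < α`, a small positive power, vanishing at the centre and unbounded at
infinity, yields `u x ≤ u y` for all `x, y` (`le_of_lt`). If `α = β`, the logarithm is the
borderline profile, infinite in size at both `0` and infinity: perturbed logarithms bound `u` by its
maximum on the unit sphere (`le_of_one_le_norm`, `le_of_norm_le_one`). That maximum is attained in
the punctured space, and a strong maximum principle (`lt_of_norm_sub_lt`) with connectedness makes
`u` constant. -/

/-! ### Eigenvalues, Rayleigh quotients and bounds for the weighted trace. -/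

theorem exists_unit_eigenvector (X : SymMat n) (i : Fin n) :
    ∃ e : Euc n, ‖e‖ = 1 ∧ Matrix.toEuclideanLin X.1 e = eig X i • e := by
  set k := Fin.cast (Fintype.card_fin n).symm i.rev
  set j := Fintype.equivOfCardEq (Fintype.card_fin (Fintype.card (Fin n))) k with hj
  refine ⟨X.2.eigenvectorBasis j, X.2.eigenvectorBasis.orthonormal.1 j, ?_⟩
  have h : X.2.eigenvalues j = eig X i := by
    simp only [Matrix.IsHermitian.eigenvalues, hj, Equiv.symm_apply_apply]
    rfl
  ext m
  have := congrFun (X.2.mulVec_eigenvectorBasis j) m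
  rw [h] at this
  simpa using this

theorem eig_eq_inner (X : SymMat n) (i : Fin n) :
    ∃ e : Euc n, ‖e‖ = 1 ∧ inner ℝ (Matrix.toEuclideanLin X.1 e) e = eig X i := by
  obtain ⟨e, he, h⟩ := exists_unit_eigenvector X i
  refine ⟨e, he, ?_⟩
  rw [h, real_inner_smul_left, real_inner_self_eq_norm_sq, he]
  ring

theorem eig_le_of_forall_inner_le {X : SymMat n} {C : ℝ}
    (hC : ∀ v : Euc n, inner ℝ (Matrix.toEuclideanLin X.1 v) v ≤ C * ‖v‖ ^ 2) (i : Fin n) :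
    eig X i ≤ C := by
  obtain ⟨e, he, h⟩ := eig_eq_inner X i
  simpa [h, he] using hC e

theorem le_eig_of_forall_le_inner {X : SymMat n} {C : ℝ}
    (hC : ∀ v : Euc n, C * ‖v‖ ^ 2 ≤ inner ℝ (Matrix.toEuclideanLin X.1 v) v) (i : Fin n) :
    C ≤ eig X i := by
  obtain ⟨e, he, h⟩ := eig_eq_inner X i
  simpa [h, he] using hC e

theorem inner_eq_sum_eigenvalues (X : SymMat n) (e : Euc n) :
    inner ℝ (Matrix.toEuclideanLin X.1 e) e =
      ∑ j, X.2.eigenvalues j * (inner ℝ (X.2.eigenvectorBasis j) e) ^ 2 := by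
  rw [← X.2.eigenvectorBasis.sum_inner_mul_inner]
  refine Finset.sum_congr rfl fun j _ => ?_
  have h : Matrix.toEuclideanLin X.1 (X.2.eigenvectorBasis j) =
      X.2.eigenvalues j • X.2.eigenvectorBasis j := by
    ext m
    simpa using congrFun (X.2.mulVec_eigenvectorBasis j) m
  have hs := (Matrix.isSymmetric_toEuclideanLin_iff.mpr X.2) e (X.2.eigenvectorBasis j)
  rw [hs, h, real_inner_smul_right, real_inner_comm e]
  ring

theorem sum_inner_eigenvectorBasis_sq (X : SymMat n) (e : Euc n) :
    ∑ j, (inner ℝ (X.2.eigenvectorBasis j) e) ^ 2 = ‖e‖ ^ 2 := by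
  simpa using X.2.eigenvectorBasis.sum_sq_norm_inner_right e

theorem exists_eigenvalues_eq_eig (X : SymMat n) (j : Fin n) :
    ∃ i, X.2.eigenvalues j = eig X i := by
  refine ⟨(Fin.cast (Fintype.card_fin n)
    ((Fintype.equivOfCardEq (Fintype.card_fin (Fintype.card (Fin n)))).symm j)).rev, ?_⟩
  simp [Matrix.IsHermitian.eigenvalues, eig]

theorem eig_monotone (X : SymMat n) : Monotone (eig X) := fun i j h =>
  X.2.eigenvalues₀_antitone (by
    simpa [Fin.le_def, Fin.rev] using (by have := Fin.le_def.1 h; omega))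

/-- In an orthonormal eigenbasis the Rayleigh quotient is an average of the eigenvalues, with
weights the squared coordinates of `e`. -/
theorem eig_first_le_inner (hn : 0 < n) (X : SymMat n) {e : Euc n} (he : ‖e‖ = 1) :
    eig X ⟨0, hn⟩ ≤ inner ℝ (Matrix.toEuclideanLin X.1 e) e := by
  have h1 := sum_inner_eigenvectorBasis_sq X e
  rw [he, one_pow] at h1
  rw [inner_eq_sum_eigenvalues, ← mul_one (eig X _), ← h1, Finset.mul_sum]
  refine Finset.sum_le_sum fun j _ => mul_le_mul_of_nonneg_right ?_ (sq_nonneg _)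
  obtain ⟨i, hi⟩ := exists_eigenvalues_eq_eig X j
  rw [hi]
  exact eig_monotone X (Fin.le_def.2 (Nat.zero_le _))

theorem inner_le_eig_last (hn : 0 < n) (X : SymMat n) {e : Euc n} (he : ‖e‖ = 1) :
    inner ℝ (Matrix.toEuclideanLin X.1 e) e ≤ eig X ⟨n - 1, Nat.sub_lt hn one_pos⟩ := by
  have h1 := sum_inner_eigenvectorBasis_sq X e
  rw [he, one_pow] at h1
  rw [inner_eq_sum_eigenvalues, ← mul_one (eig X _), ← h1, Finset.mul_sum]
  refine Finset.sum_le_sum fun j _ => mul_le_mul_of_nonneg_right ?_ (sq_nonneg _)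
  obtain ⟨i, hi⟩ := exists_eigenvalues_eq_eig X j
  rw [hi]
  exact eig_monotone X (Fin.le_def.2 (Nat.le_sub_one_of_lt i.2))

theorem complWeight_eq_sum_erase (a : Fin n → ℝ) (j : Fin n) :
    complWeight a j = ∑ i ∈ Finset.univ.erase j, a i := by
  rw [complWeight, ← Finset.add_sum_erase _ _ (Finset.mem_univ j)]
  ring

theorem complWeight_nonneg {a : Fin n → ℝ} (ha : ∀ i, 0 ≤ a i) (j : Fin n) :
    0 ≤ complWeight a j := by
  rw [complWeight_eq_sum_erase]
  exact Finset.sum_nonneg fun i _ => ha i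

theorem weightedTrace_eq_add (a : Fin n → ℝ) (X : SymMat n) (j : Fin n) :
    weightedTrace a X = a j * eig X j + ∑ i ∈ Finset.univ.erase j, a i * eig X i := by
  rw [weightedTrace, ← Finset.add_sum_erase _ _ (Finset.mem_univ j)]

theorem weightedTrace_le (hn : 0 < n) {a : Fin n → ℝ} (ha : ∀ i, 0 ≤ a i) {X : SymMat n}
    {e : Euc n} (he : ‖e‖ = 1) {C : ℝ}
    (hC : ∀ v : Euc n, inner ℝ (Matrix.toEuclideanLin X.1 v) v ≤ C * ‖v‖ ^ 2) :
    weightedTrace a X ≤ a ⟨0, hn⟩ * inner ℝ (Matrix.toEuclideanLin X.1 e) e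
      + complWeight a ⟨0, hn⟩ * C := by
  rw [weightedTrace_eq_add a X ⟨0, hn⟩, complWeight_eq_sum_erase, Finset.sum_mul]
  exact add_le_add (mul_le_mul_of_nonneg_left (eig_first_le_inner hn X he) (ha _))
    (Finset.sum_le_sum fun i _ =>
      mul_le_mul_of_nonneg_left (eig_le_of_forall_inner_le hC i) (ha i))

theorem le_weightedTrace (hn : 0 < n) {a : Fin n → ℝ} (ha : ∀ i, 0 ≤ a i) {X : SymMat n}
    {e : Euc n} (he : ‖e‖ = 1) {C : ℝ}
    (hC : ∀ v : Euc n, C * ‖v‖ ^ 2 ≤ inner ℝ (Matrix.toEuclideanLin X.1 v) v) :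
    a ⟨n - 1, Nat.sub_lt hn one_pos⟩ * inner ℝ (Matrix.toEuclideanLin X.1 e) e
      + complWeight a ⟨n - 1, Nat.sub_lt hn one_pos⟩ * C ≤ weightedTrace a X := by
  rw [weightedTrace_eq_add a X ⟨n - 1, Nat.sub_lt hn one_pos⟩, complWeight_eq_sum_erase,
    Finset.sum_mul]
  exact add_le_add (mul_le_mul_of_nonneg_left (inner_le_eig_last hn X he) (ha _))
    (Finset.sum_le_sum fun i _ =>
      mul_le_mul_of_nonneg_left (le_eig_of_forall_le_inner hC i) (ha i))

/-! ### The extremal differential inequality. -/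

/-- Upper semicontinuity together with the differential inequality
`0 ≤ α ⟨X e, e⟩ + β C`, for every superjet `(ξ, X)`, every unit vector `e` and every upper
bound `C` of the quadratic form of `X`. -/
def IsExtremalSubsolution (α β : ℝ) (O : Set (Euc n)) (u : Euc n → ℝ) : Prop :=
  UpperSemicontinuousOn u O ∧
    ∀ x ∈ O, ∀ ξ : Euc n, ∀ X : SymMat n, (ξ, X) ∈ superjet O u x →
      ∀ e : Euc n, ‖e‖ = 1 → ∀ C : ℝ,
        (∀ v : Euc n, inner ℝ (Matrix.toEuclideanLin X.1 v) v ≤ C * ‖v‖ ^ 2) →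
        0 ≤ α * inner ℝ (Matrix.toEuclideanLin X.1 e) e + β * C

theorem IsViscositySubsolution.isExtremalSubsolution (hn : 0 < n) {a : Fin n → ℝ}
    (ha : ∀ i, 0 ≤ a i) {O : Set (Euc n)} {u : Euc n → ℝ}
    (hu : IsViscositySubsolution (weightedTrace a) (fun _ => 0) O u) :
    IsExtremalSubsolution (a ⟨0, hn⟩) (complWeight a ⟨0, hn⟩) O u :=
  ⟨hu.1, fun x hx ξ X hX _ he _ hC => (hu.2 x hx ξ X hX).trans (weightedTrace_le hn ha he hC)⟩

theorem neg_mem_subjet_neg {O : Set (Euc n)} {v : Euc n → ℝ} {x₀ ξ : Euc n} {X : SymMat n}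
    (h : (ξ, X) ∈ superjet O (fun x => -v x) x₀) :
    ((-ξ, ⟨-X.1, X.2.neg⟩) : Euc n × SymMat n) ∈ subjet O v x₀ := by
  obtain ⟨ρ, hρ, h⟩ := h
  refine ⟨fun x => -ρ x, hρ.neg_left, h.mono fun x hx => ?_⟩
  simp only [quadPoly, map_neg, LinearMap.neg_apply, inner_neg_left] at hx ⊢
  linarith

theorem IsViscositySupersolution.isExtremalSubsolution_neg (hn : 0 < n) {a : Fin n → ℝ}
    (ha : ∀ i, 0 ≤ a i) {O : Set (Euc n)} {v : Euc n → ℝ}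
    (hv : IsViscositySupersolution (weightedTrace a) (fun _ => 0) O v) :
    IsExtremalSubsolution (a ⟨n - 1, Nat.sub_lt hn one_pos⟩)
      (complWeight a ⟨n - 1, Nat.sub_lt hn one_pos⟩) O (fun x => -v x) := by
  refine ⟨fun x hx y hy => ?_, fun x hx ξ X hX e he C hC => ?_⟩
  · filter_upwards [hv.1 x hx (-y) (by linarith)] with z hz
    linarith
  · have h := hv.2 x hx _ _ (neg_mem_subjet_neg hX)
    have h' := le_weightedTrace hn ha (X := ⟨-X.1, X.2.neg⟩) he (C := -C) (fun w => by
      simp only [map_neg, LinearMap.neg_apply, inner_neg_left]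
      linarith [hC w])
    simp only [map_neg, LinearMap.neg_apply, inner_neg_left] at h'
    linarith

/-! ### Radial test functions. -/

/-- The Hessian of `x ↦ g (‖x - y‖ ^ 2)` at `y + z`, where `p` and `q` are the first two
derivatives of `g` at `‖z‖ ^ 2`. -/
def radialHessian (p q : ℝ) (z : Euc n) : SymMat n :=
  ⟨(2 * p) • 1 + (4 * q) • Matrix.vecMulVec z.ofLp z.ofLp, by
    ext i j
    simp [Matrix.vecMulVec_apply, Matrix.one_apply, eq_comm, mul_comm]⟩

theorem inner_radialHessian (p q : ℝ) (z v : Euc n) :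
    inner ℝ (Matrix.toEuclideanLin (radialHessian p q z).1 v) v =
      2 * p * ‖v‖ ^ 2 + 4 * q * (inner ℝ z v) ^ 2 := by
  have h : Matrix.toEuclideanLin (radialHessian p q z).1 v =
      (2 * p) • v + (4 * q * inner ℝ z v) • z := by
    ext i
    simp [radialHessian, Matrix.vecMulVec_mulVec,
      EuclideanSpace.inner_eq_star_dotProduct, dotProduct_comm]
    ring
  rw [h, inner_add_left, real_inner_smul_left, real_inner_smul_left, real_inner_self_eq_norm_sq]
  ring

/-- Subtracting the quadratic part leaves a function whose derivative is `o(s - s₀)`; the mean value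
inequality raises the order by one. Thus `g'` need only be differentiable at `s₀`. -/
theorem isLittleO_second_order_taylor {g g' : ℝ → ℝ} {q s₀ : ℝ}
    (hg : ∀ᶠ s in 𝓝 s₀, HasDerivAt g (g' s) s) (hg' : HasDerivAt g' q s₀) :
    (fun s => g s - g s₀ - g' s₀ * (s - s₀) - q / 2 * (s - s₀) ^ 2) =o[𝓝 s₀]
      fun s => (s - s₀) ^ 2 := by
  obtain ⟨r, hr, hball⟩ := Metric.eventually_nhds_iff_ball.1 hg
  have hmem := Metric.mem_ball_self (x := s₀) hr
  have h1 : (fun s => g' s - g' s₀ - (s - s₀) * q) =o[𝓝[Metric.ball s₀ r] s₀]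
      fun s => (s - s₀) ^ 1 := by
    simpa using (hasDerivAt_iff_isLittleO.1 hg').mono nhdsWithin_le_nhds
  have h2 := (convex_ball s₀ r).isLittleO_pow_succ_real
    (f := fun s => g s - g' s₀ * (s - s₀) - q / 2 * (s - s₀) ^ 2) hmem (fun s hs => by
      have hd := (((hball s hs).sub (((hasDerivAt_id s).sub_const s₀).const_mul (g' s₀))).sub
        ((((hasDerivAt_id s).sub_const s₀).pow 2).const_mul (q / 2)))
      refine (hd.congr_deriv ?_).hasDerivWithinAt
      simp
      ring) h1
  rw [Metric.isOpen_ball.nhdsWithin_eq hmem] at h2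
  refine h2.congr_left fun s => ?_
  simp
  ring

theorem normSq_sub_eq (x x₀ y : Euc n) :
    ‖x - y‖ ^ 2 - ‖x₀ - y‖ ^ 2 = 2 * inner ℝ (x₀ - y) (x - x₀) + ‖x - x₀‖ ^ 2 := by
  have h : x - y = (x₀ - y) + (x - x₀) := by abel
  rw [h, norm_add_sq_real]
  ring

theorem radial_mem_superjet {O : Set (Euc n)} {u : Euc n → ℝ} {x₀ y : Euc n} {g g' : ℝ → ℝ}
    {q : ℝ} (hg : ∀ᶠ s in 𝓝 (‖x₀ - y‖ ^ 2), HasDerivAt g (g' s) s)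
    (hg' : HasDerivAt g' q (‖x₀ - y‖ ^ 2))
    (hu : ∀ᶠ x in 𝓝 x₀, u x - g (‖x - y‖ ^ 2) ≤ u x₀ - g (‖x₀ - y‖ ^ 2)) :
    ((2 * g' (‖x₀ - y‖ ^ 2)) • (x₀ - y), radialHessian (g' (‖x₀ - y‖ ^ 2)) q (x₀ - y)) ∈
      superjet O u x₀ := by
  set z := x₀ - y with hz
  set s₀ := ‖z‖ ^ 2 with hs₀
  have hsub : Tendsto (fun x : Euc n => x - x₀) (𝓝 x₀) (𝓝 0) := by
    simpa using (continuous_sub_right x₀).tendsto x₀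
  have hnorm : (fun x : Euc n => ‖x - x₀‖) =o[𝓝 x₀] fun _ => (1 : ℝ) := by
    rw [isLittleO_one_iff]
    simpa using hsub.norm
  have hinner : (fun x : Euc n => inner ℝ z (x - x₀)) =O[𝓝 x₀] fun x => ‖x - x₀‖ :=
    IsBigO.of_bound ‖z‖ (Eventually.of_forall fun x => by
      simpa using norm_inner_le_norm (𝕜 := ℝ) z (x - x₀))
  have hsq : (fun x : Euc n => ‖x - x₀‖ ^ 2) =o[𝓝 x₀] fun x => ‖x - x₀‖ := by
    simpa [sq] using hnorm.mul_isBigO (isBigO_refl (fun x : Euc n => ‖x - x₀‖) (𝓝 x₀))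
  have hs : (fun x : Euc n => ‖x - y‖ ^ 2 - s₀) =O[𝓝 x₀] fun x => ‖x - x₀‖ := by
    simp only [hs₀, hz, normSq_sub_eq]
    exact (hinner.const_mul_left 2).add hsq.isBigO
  have ht : Tendsto (fun x : Euc n => ‖x - y‖ ^ 2) (𝓝 x₀) (𝓝 s₀) :=
    ((continuous_id.sub continuous_const).norm.pow 2).tendsto x₀
  have h1 := ((isLittleO_second_order_taylor hg hg').comp_tendsto ht).trans_isBigO (hs.pow 2)
  -- With `t = 2 ⟨z, x - x₀⟩ + ‖x - x₀‖ ^ 2` the increment of the squared distance, this is `q / 2`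
  -- times `t ^ 2 - 4 ⟨z, x - x₀⟩ ^ 2`, the part of the quadratic term that the Hessian omits.
  have h2 : (fun x : Euc n => q / 2 * (‖x - x₀‖ ^ 2 *
      (4 * inner ℝ z (x - x₀) + ‖x - x₀‖ ^ 2))) =o[𝓝 x₀] fun x => ‖x - x₀‖ ^ 2 := by
    refine IsLittleO.const_mul_left ?_ _
    simpa [sq] using hsq.mul_isBigO ((hinner.const_mul_left 4).add hsq.isBigO)
  refine ⟨_, (h1.add h2).mono nhdsWithin_le_nhds, nhdsWithin_le_nhds (hu.mono fun x hx => ?_)⟩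
  have hd := normSq_sub_eq x x₀ y
  simp only [quadPoly, inner_radialHessian, real_inner_smul_left, Function.comp_apply]
  rw [← hz, ← hs₀] at hd
  rw [hd]
  nlinarith [hx]

/-- The condition on the first two derivatives `p`, `q` at `s` of a profile `g` under which
`x ↦ g (‖x - y‖ ^ 2)` violates the differential inequality of extremal subsolutions at the
points with `‖x - y‖ ^ 2 = s`. -/
def StrictProfileAt (n : ℕ) (α β p q s : ℝ) : Prop :=
  (q ≤ 0 ∧ α * (p + 2 * q * s) + β * p < 0) ∨
    (0 ≤ q ∧ 2 ≤ n ∧ α * p + β * (p + 2 * q * s) < 0)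

theorem exists_unit_inner_eq_zero (hn : 2 ≤ n) (z : Euc n) :
    ∃ e : Euc n, ‖e‖ = 1 ∧ inner ℝ z e = 0 := by
  have hlt : Module.finrank ℝ (ℝ ∙ z) < Module.finrank ℝ (Euc n) :=
    by
    refine (finrank_span_le_card ({z} : Set (Euc n))).trans_lt ?_
    simpa using Nat.lt_of_succ_le hn
  have hne : (ℝ ∙ z)ᗮ ≠ ⊥ := fun h => by
    rw [Submodule.orthogonal_eq_bot_iff] at h
    rw [h, finrank_top] at hlt
    exact lt_irrefl _ hlt
  obtain ⟨v, hv, hv0⟩ := Submodule.exists_mem_ne_zero_of_ne_bot hne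
  refine ⟨‖v‖⁻¹ • v, norm_smul_inv_norm hv0, ?_⟩
  rw [real_inner_smul_right, Submodule.mem_orthogonal_singleton_iff_inner_right.1 hv, mul_zero]

theorem IsExtremalSubsolution.not_strictProfileAt {α β : ℝ} {O : Set (Euc n)} {u : Euc n → ℝ}
    (h : IsExtremalSubsolution α β O u) {x₀ y : Euc n} (hx₀ : x₀ ∈ O) (hy : x₀ ≠ y)
    {g g' : ℝ → ℝ} {q : ℝ} (hg : ∀ᶠ s in 𝓝 (‖x₀ - y‖ ^ 2), HasDerivAt g (g' s) s)
    (hg' : HasDerivAt g' q (‖x₀ - y‖ ^ 2))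
    (hu : ∀ᶠ x in 𝓝 x₀, u x - g (‖x - y‖ ^ 2) ≤ u x₀ - g (‖x₀ - y‖ ^ 2)) :
    ¬ StrictProfileAt n α β (g' (‖x₀ - y‖ ^ 2)) q (‖x₀ - y‖ ^ 2) := by
  have hjet := h.2 x₀ hx₀ _ _ (radial_mem_superjet hg hg' hu)
  set z := x₀ - y
  have hz : z ≠ 0 := sub_ne_zero.2 hy
  simp only [inner_radialHessian] at hjet
  rintro (⟨hq, hlt⟩ | ⟨hq, hn, hlt⟩)
  -- For `q ≤ 0` the form is smallest in the radial direction, and `2 p` bounds it from above.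
  · have := hjet (‖z‖⁻¹ • z) (norm_smul_inv_norm hz) (2 * g' (‖z‖ ^ 2))
      (fun v => by nlinarith [mul_nonneg (neg_nonneg.2 hq) (sq_nonneg (inner ℝ z v))])
    have he : inner ℝ z (‖z‖⁻¹ • z) = ‖z‖ := by
      rw [real_inner_smul_right, real_inner_self_eq_norm_sq]
      field_simp
    have he1 : ‖‖z‖⁻¹ • z‖ = 1 := norm_smul_inv_norm hz
    rw [he, he1] at this
    nlinarith
  -- For `q ≥ 0` the roles swap: tangential directions give the smallest value `2 p`, the radial one
  -- the largest.
  · obtain ⟨e, he, hze⟩ := exists_unit_inner_eq_zero hn z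
    have := hjet e he (2 * g' (‖z‖ ^ 2) + 4 * q * ‖z‖ ^ 2) (fun v => by
      have : (inner ℝ z v) ^ 2 ≤ ‖z‖ ^ 2 * ‖v‖ ^ 2 := by
        rw [← mul_pow]
        exact sq_le_sq.2 (by
          rw [abs_of_nonneg (mul_nonneg (norm_nonneg z) (norm_nonneg v))]
          exact abs_real_inner_le_norm z v)
      nlinarith)
    rw [hze, he] at this
    nlinarith

/-! ### Comparison on annuli. -/

/-- Comparison with a strict radial supersolution on a closed annulus (a closed ball if
`r = 0`). -/
theorem IsExtremalSubsolution.le_of_le_sphere {α β : ℝ} {O : Set (Euc n)} {u : Euc n → ℝ}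
    (h : IsExtremalSubsolution α β O u) {y : Euc n} {r R c : ℝ} (hr : 0 ≤ r)
    (hO : ∀ x, r ≤ ‖x - y‖ → ‖x - y‖ ≤ R → x ∈ O) {g g' g'' : ℝ → ℝ}
    (hc : ContinuousOn g (Set.Icc (r ^ 2) (R ^ 2)))
    (hg : ∀ s ∈ Set.Ioo (r ^ 2) (R ^ 2), HasDerivAt g (g' s) s)
    (hg' : ∀ s ∈ Set.Ioo (r ^ 2) (R ^ 2), HasDerivAt g' (g'' s) s)
    (hstrict : ∀ s ∈ Set.Ioo (r ^ 2) (R ^ 2), StrictProfileAt n α β (g' s) (g'' s) s)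
    (hin : ∀ x, ‖x - y‖ = r → u x ≤ c + g (r ^ 2))
    (hout : ∀ x, ‖x - y‖ = R → u x ≤ c + g (R ^ 2))
    {x : Euc n} (hx₁ : r ≤ ‖x - y‖) (hx₂ : ‖x - y‖ ≤ R) : u x ≤ c + g (‖x - y‖ ^ 2) := by
  set K : Set (Euc n) := {x | r ≤ ‖x - y‖ ∧ ‖x - y‖ ≤ R}
  have hcont : Continuous fun x : Euc n => ‖x - y‖ := (continuous_id.sub continuous_const).norm
  have hK : IsCompact K := by
    refine (isCompact_closedBall y R).of_isClosed_subset
      ((isClosed_le continuous_const hcont).inter (isClosed_le hcont continuous_const)) ?_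
    intro w hw
    simpa [dist_eq_norm] using hw.2
  have husc : UpperSemicontinuousOn (fun x => u x + -g (‖x - y‖ ^ 2)) K := by
    refine (h.1.mono fun w hw => hO w hw.1 hw.2).add (ContinuousOn.upperSemicontinuousOn ?_)
    refine (hc.comp (hcont.pow 2).continuousOn fun w hw => ?_).neg
    exact ⟨pow_le_pow_left₀ hr hw.1 2, pow_le_pow_left₀ (norm_nonneg _) hw.2 2⟩
  have hxK : x ∈ K := ⟨hx₁, hx₂⟩
  obtain ⟨x₀, hx₀, hmax⟩ := UpperSemicontinuousOn.exists_isMaxOn ⟨x, hxK⟩ hK husc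
  suffices u x₀ ≤ c + g (‖x₀ - y‖ ^ 2) by
    have := isMaxOn_iff.1 hmax x hxK
    linarith
  -- If `r = 0` the centre counts as the inner sphere, so a possibly singular derivative of `g`
  -- there does no harm.
  rcases hx₀.1.eq_or_lt with h1 | h1
  · rw [← h1]
    exact hin x₀ h1.symm
  rcases hx₀.2.eq_or_lt with h2 | h2
  · rw [h2]
    exact hout x₀ h2
  have hs : ‖x₀ - y‖ ^ 2 ∈ Set.Ioo (r ^ 2) (R ^ 2) :=
    ⟨pow_lt_pow_left₀ h1 hr two_ne_zero, pow_lt_pow_left₀ h2 (norm_nonneg _) two_ne_zero⟩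
  refine absurd (hstrict _ hs) (h.not_strictProfileAt (hO x₀ hx₀.1 hx₀.2)
    (fun he => by simp [he] at h1; linarith) (g := g) ?_ (hg' _ hs) ?_)
  · exact (isOpen_Ioo.eventually_mem hs).mono hg
  · have hx₀mem : ‖x₀ - y‖ ∈ Set.Ioo r R := ⟨h1, h2⟩
    filter_upwards [hcont.continuousAt.eventually (isOpen_Ioo.eventually_mem hx₀mem)] with w hw
    have := isMaxOn_iff.1 hmax w ⟨hw.1.le, hw.2.le⟩
    linarith

/-! ### Liouville property on the whole space and on the punctured space. -/

theorem le_of_forall_pos_le_add_mul {a b k : ℝ} (h : ∀ ε > 0, a ≤ b + ε * k) : a ≤ b := by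
  have ht : Tendsto (fun ε : ℝ => b + ε * k) (𝓝[>] 0) (𝓝 b) := by
    have : Tendsto (fun ε : ℝ => b + ε * k) (𝓝 0) (𝓝 (b + 0 * k)) :=
      Continuous.tendsto (by fun_prop) 0
    rw [zero_mul, add_zero] at this
    exact this.mono_left nhdsWithin_le_nhds
  exact ge_of_tendsto ht (eventually_mem_nhdsWithin.mono h)

theorem IsExtremalSubsolution.le_of_lt {α β : ℝ} (hβ : 0 ≤ β) (hαβ : β < α) {u : Euc n → ℝ}
    (h : IsExtremalSubsolution α β Set.univ u) (hb : BddAbove (Set.range u)) (x y : Euc n) :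
    u x ≤ u y := by
  have hα : 0 < α := hβ.trans_lt hαβ
  obtain ⟨B, hB⟩ := hb
  -- The power `s ^ b` is strict when `α (2 b - 1) + β < 0`; this `b` makes that quantity `-(α - β)
  -- / 2`.
  set b : ℝ := (α - β) / (4 * α) with hbdef
  have hb0 : 0 < b := div_pos (sub_pos.2 hαβ) (by positivity)
  have hbα : 4 * α * b = α - β := by rw [hbdef]; field_simp
  have hb1 : b < 1 := by nlinarith
  refine le_of_forall_pos_le_add_mul (k := (‖x - y‖ ^ 2) ^ b) fun ε hε => ?_
  have ht : Tendsto (fun R : ℝ => u y + ε * (R ^ 2) ^ b) atTop atTop :=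
    tendsto_atTop_add_const_left _ _ (((tendsto_rpow_atTop hb0).comp
      (tendsto_pow_atTop two_ne_zero)).const_mul_atTop hε)
  obtain ⟨R, hR, hxR⟩ := ((ht.eventually_ge_atTop B).and (eventually_ge_atTop ‖x - y‖)).exists
  refine h.le_of_le_sphere (g := fun s => ε * s ^ b) (g' := fun s => ε * (b * s ^ (b - 1)))
    (g'' := fun s => ε * (b * ((b - 1) * s ^ (b - 1 - 1)))) le_rfl (fun _ _ _ => trivial)
    ?_ ?_ ?_ ?_ ?_ ?_ (norm_nonneg _) hxR
  · exact ((Real.continuous_rpow_const hb0.le).const_mul ε).continuousOn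
  · intro s hs
    have hs0 : 0 < s := by simpa using hs.1
    exact (Real.hasDerivAt_rpow_const (Or.inl hs0.ne')).const_mul ε
  · intro s hs
    have hs0 : 0 < s := by simpa using hs.1
    exact ((Real.hasDerivAt_rpow_const (Or.inl hs0.ne')).const_mul b).const_mul ε
  · intro s hs
    have hs0 : 0 < s := by simpa using hs.1
    have hp : s ^ (b - 1) = s ^ (b - 1 - 1) * s := by
      rw [Real.rpow_sub_one hs0.ne' (b - 1)]
      field_simp
    have hpos : 0 < ε * b * s ^ (b - 1 - 1) := by positivity
    refine Or.inl ⟨?_, ?_⟩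
    · nlinarith
    · rw [hp]
      have : α * (2 * b - 1) + β < 0 := by nlinarith
      nlinarith [mul_pos (mul_pos hpos hs0) (neg_pos.2 this)]
  · intro w hw
    obtain rfl : w = y := by simpa [sub_eq_zero] using hw
    simp [Real.zero_rpow hb0.ne']
  · intro w _
    exact (hB ⟨w, rfl⟩).trans hR

/-- For `g = log s` the expression `(p + 2 q s) + p` is zero. The term `-s⁻¹` makes it strictly
negative, and `+ 1` makes the profile vanish on the unit sphere. -/
theorem IsExtremalSubsolution.le_of_one_le_norm {α M : ℝ} (hα : 0 < α) {u : Euc n → ℝ}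
    (h : IsExtremalSubsolution α α {0}ᶜ u) (hb : BddAbove (u '' {0}ᶜ))
    (hM : ∀ x, ‖x‖ = 1 → u x ≤ M) {x : Euc n} (hx : 1 ≤ ‖x‖) : u x ≤ M := by
  obtain ⟨B, hB⟩ := hb
  refine le_of_forall_pos_le_add_mul
    (k := Real.log (‖x‖ ^ 2) - (‖x‖ ^ 2)⁻¹ + 1) fun ε hε => ?_
  have ht : Tendsto (fun R : ℝ => M + ε * Real.log (R ^ 2)) atTop atTop :=
    tendsto_atTop_add_const_left _ _ ((Real.tendsto_log_atTop.comp
      (tendsto_pow_atTop two_ne_zero)).const_mul_atTop hε)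
  obtain ⟨R, hR, hxR⟩ := ((ht.eventually_ge_atTop B).and (eventually_ge_atTop ‖x‖)).exists
  have hpos : ∀ {s : ℝ}, s ∈ Set.Ioo ((1 : ℝ) ^ 2) (R ^ 2) → 0 < s := fun hs => by
    have := hs.1
    linarith
  have hne : ∀ w : Euc n, 1 ≤ ‖w - 0‖ → w ∈ ({0}ᶜ : Set (Euc n)) := by
    rintro w hw rfl
    norm_num at hw
  have key := h.le_of_le_sphere (y := 0) (r := 1) (R := R) (c := M) (x := x)
    (g := fun s => ε * (Real.log s - s⁻¹ + 1))
    (g' := fun s => ε * (s⁻¹ + (s ^ 2)⁻¹))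
    (g'' := fun s => ε * (-(s ^ 2)⁻¹ - 2 * s / (s ^ 2) ^ 2)) zero_le_one
    (fun w hw _ => hne w hw) ?_ ?_ ?_ ?_ ?_ ?_ (by simpa using hx) (by simpa using hxR)
  · simpa using key
  · intro s hs
    have hs0 : s ≠ 0 := by
      have := hs.1
      linarith
    exact ContinuousAt.continuousWithinAt (by fun_prop (disch := assumption))
  · intro s hs
    have hs0 := (hpos hs).ne'
    refine ((((Real.hasDerivAt_log hs0).sub (hasDerivAt_inv hs0)).add_const 1).const_mul
      ε).congr_deriv ?_
    ring
  · intro s hs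
    have hs0 := (hpos hs).ne'
    refine (((hasDerivAt_inv hs0).add ((hasDerivAt_pow 2 s).inv (pow_ne_zero 2 hs0))).const_mul
      ε).congr_deriv ?_
    simp only [Nat.cast_ofNat]
    ring
  · intro s hs
    have hs0 := hpos hs
    refine Or.inl ⟨?_, ?_⟩
    · have : 0 ≤ (s ^ 2)⁻¹ + 2 * s / (s ^ 2) ^ 2 := by positivity
      nlinarith
    · have : α * (ε * (s⁻¹ + (s ^ 2)⁻¹) + 2 * (ε * (-(s ^ 2)⁻¹ - 2 * s / (s ^ 2) ^ 2)) * s) +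
          α * (ε * (s⁻¹ + (s ^ 2)⁻¹)) = -(2 * α * ε * (s ^ 2)⁻¹) := by
        field_simp
        ring
      rw [this, neg_lt_zero]
      positivity
  · intro w hw
    simpa using hM w (by simpa using hw)
  · intro w hw
    have hR1 : 1 ≤ R := hx.trans hxR
    have h1 : (R ^ 2)⁻¹ ≤ 1 := inv_le_one_of_one_le₀ (one_le_pow₀ hR1)
    have h2 := hB ⟨w, hne w (hw ▸ hR1), rfl⟩
    nlinarith

/-- Here `-log s` beats the bound on `u` near the origin. It is convex in `s`, so the tangential
alternative of `StrictProfileAt` applies, whence `2 ≤ n`; the term `-s` gives strictness. -/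
theorem IsExtremalSubsolution.le_of_norm_le_one (hn : 2 ≤ n) {α M : ℝ} (hα : 0 < α)
    {u : Euc n → ℝ} (h : IsExtremalSubsolution α α {0}ᶜ u) (hb : BddAbove (u '' {0}ᶜ))
    (hM : ∀ x, ‖x‖ = 1 → u x ≤ M) {x : Euc n} (hx₀ : x ≠ 0) (hx : ‖x‖ ≤ 1) : u x ≤ M := by
  obtain ⟨B, hB⟩ := hb
  refine le_of_forall_pos_le_add_mul
    (k := -Real.log (‖x‖ ^ 2) - ‖x‖ ^ 2 + 1) fun ε hε => ?_
  have ht : Tendsto (fun r : ℝ => M + ε * -Real.log (r ^ 2)) (𝓝[>] 0) atTop := by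
    refine tendsto_atTop_add_const_left _ _ (Tendsto.const_mul_atTop hε
      (tendsto_neg_atBot_atTop.comp (Real.tendsto_log_nhdsGT_zero.comp ?_)))
    refine tendsto_nhdsWithin_iff.2 ⟨?_, eventually_mem_nhdsWithin.mono fun r hr => ?_⟩
    · exact (Continuous.tendsto' (by fun_prop) 0 0 (by simp)).mono_left nhdsWithin_le_nhds
    · exact pow_pos (Set.mem_Ioi.1 hr) 2
  obtain ⟨r, ⟨hr, hxr⟩, hr0⟩ := (((ht.eventually_ge_atTop B).and
    (nhdsWithin_le_nhds (eventually_le_nhds (norm_pos_iff.2 hx₀)))).and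
      eventually_mem_nhdsWithin).exists
  replace hr0 : 0 < r := hr0
  have hpos : ∀ {s : ℝ}, r ^ 2 ≤ s → 0 < s := fun hs => (pow_pos hr0 2).trans_le hs
  have hne : ∀ w : Euc n, r ≤ ‖w - 0‖ → w ∈ ({0}ᶜ : Set (Euc n)) := by
    rintro w hw rfl
    simp at hw
    linarith
  have key := h.le_of_le_sphere (y := 0) (r := r) (R := 1) (c := M) (x := x)
    (g := fun s => ε * (-Real.log s - s + 1))
    (g' := fun s => ε * (-s⁻¹ - 1))
    (g'' := fun s => ε * (s ^ 2)⁻¹) hr0.le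
    (fun w hw _ => hne w hw) ?_ ?_ ?_ ?_ ?_ ?_ (by simpa using hxr) (by simpa using hx)
  · simpa using key
  · intro s hs
    have hs0 : s ≠ 0 := (hpos hs.1).ne'
    exact ContinuousAt.continuousWithinAt (by fun_prop (disch := assumption))
  · intro s hs
    have hs0 := (hpos hs.1.le).ne'
    exact ((((Real.hasDerivAt_log hs0).neg.sub (hasDerivAt_id s)).add_const 1).const_mul ε)
  · intro s hs
    have hs0 := (hpos hs.1.le).ne'
    refine (((hasDerivAt_inv hs0).neg.sub_const 1).const_mul ε).congr_deriv ?_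
    ring
  · intro s hs
    have hs0 := hpos hs.1.le
    refine Or.inr ⟨by positivity, hn, ?_⟩
    have : α * (ε * (-s⁻¹ - 1)) + α * (ε * (-s⁻¹ - 1) + 2 * (ε * (s ^ 2)⁻¹) * s) =
        -(2 * α * ε) := by
      field_simp
      ring
    rw [this, neg_lt_zero]
    positivity
  · intro w hw
    have h1 : r ^ 2 ≤ 1 := pow_le_one₀ hr0.le (hxr.trans hx)
    have h2 := hB ⟨w, hne w hw.ge, rfl⟩
    nlinarith
  · intro w hw
    simpa using hM w (by simpa using hw)

/-- Hopf-type barrier: semicontinuity keeps `u` below some `m < M` near `y`, and an increasing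
profile in `-s⁻¹` carries the strict inequality out to any sphere about `y` that does not reach the
origin. -/
theorem IsExtremalSubsolution.lt_of_norm_sub_lt {α M : ℝ} (hα : 0 < α) {u : Euc n → ℝ}
    (h : IsExtremalSubsolution α α {0}ᶜ u) (hM : ∀ x, x ≠ 0 → u x ≤ M) {x y : Euc n}
    (hy : u y < M) (hxy : ‖x - y‖ < ‖y‖) : u x < M := by
  have hy0 : y ≠ 0 := by
    rintro rfl
    simp at hxy
    exact absurd hxy (norm_nonneg x).not_gt
  obtain ⟨m, hym, hmM⟩ := exists_between hy
  have hnhds : ∀ᶠ w in 𝓝 y, u w < m := by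
    have := h.1 y hy0 m hym
    rwa [isOpen_compl_singleton.nhdsWithin_eq hy0] at this
  obtain ⟨r₀, hr₀, hball⟩ := Metric.eventually_nhds_iff.1 hnhds
  rcases lt_or_ge ‖x - y‖ (r₀ / 2) with hlt | hge
  · exact (hball (by rw [dist_eq_norm]; linarith)).trans hmM
  set r := r₀ / 2
  have hr : 0 < r := half_pos hr₀
  obtain ⟨R, hxR, hRy⟩ := exists_between hxy
  have hrR : r < R := hge.trans_lt hxR
  have hR : 0 < R := hr.trans hrR
  have hinv : (R ^ 2)⁻¹ < (r ^ 2)⁻¹ :=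
    inv_strictAnti₀ (pow_pos hr 2) (pow_lt_pow_left₀ hrR hr.le two_ne_zero)
  have hpos : ∀ {s : ℝ}, r ^ 2 ≤ s → 0 < s := fun hs => (pow_pos hr 2).trans_le hs
  have hne : ∀ w : Euc n, ‖w - y‖ ≤ R → w ∈ ({0}ᶜ : Set (Euc n)) := by
    rintro w hw rfl
    rw [zero_sub, norm_neg] at hw
    linarith
  -- This scaling makes `M + g` equal to `m` on the inner sphere and `M` on the outer one.
  set κ := (M - m) / ((r ^ 2)⁻¹ - (R ^ 2)⁻¹) with hκ
  have hκ0 : 0 < κ := div_pos (sub_pos.2 hmM) (sub_pos.2 hinv)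
  have hκm : κ * ((r ^ 2)⁻¹ - (R ^ 2)⁻¹) = M - m := div_mul_cancel₀ _ (sub_pos.2 hinv).ne'
  have key := h.le_of_le_sphere (y := y) (r := r) (R := R) (c := M) (x := x)
    (g := fun s => κ * ((R ^ 2)⁻¹ - s⁻¹))
    (g' := fun s => κ * (s ^ 2)⁻¹)
    (g'' := fun s => κ * (-(2 * s) / (s ^ 2) ^ 2)) hr.le
    (fun w _ hw => hne w hw) ?_ ?_ ?_ ?_ ?_ ?_ hge hxR.le
  · have hx0 : 0 < ‖x - y‖ := hr.trans_le hge
    have : (R ^ 2)⁻¹ < (‖x - y‖ ^ 2)⁻¹ :=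
      inv_strictAnti₀ (pow_pos hx0 2) (pow_lt_pow_left₀ hxR hx0.le two_ne_zero)
    nlinarith
  · intro s hs
    have hs0 : s ≠ 0 := (hpos hs.1).ne'
    exact ContinuousAt.continuousWithinAt (by fun_prop (disch := assumption))
  · intro s hs
    have hs0 := (hpos hs.1.le).ne'
    refine (((hasDerivAt_inv hs0).const_sub _).const_mul κ).congr_deriv ?_
    ring
  · intro s hs
    have hs0 := (hpos hs.1.le).ne'
    refine (((hasDerivAt_pow 2 s).inv (pow_ne_zero 2 hs0)).const_mul κ).congr_deriv ?_
    norm_num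
  · intro s hs
    have hs0 := hpos hs.1.le
    refine Or.inl ⟨?_, ?_⟩
    · rw [neg_div, mul_neg, neg_nonpos]
      positivity
    · have : α * (κ * (s ^ 2)⁻¹ + 2 * (κ * (-(2 * s) / (s ^ 2) ^ 2)) * s) +
          α * (κ * (s ^ 2)⁻¹) = -(2 * α * κ * (s ^ 2)⁻¹) := by
        field_simp
        ring
      rw [this, neg_lt_zero]
      positivity
  · intro w hw
    have : u w < m := hball (by rw [dist_eq_norm, hw]; exact half_lt_self hr₀)
    linarith
  · intro w hw
    simpa using hM w (hne w hw.le)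

theorem IsExtremalSubsolution.exists_eq_const (hn : 2 ≤ n) {α : ℝ} (hα : 0 < α)
    {u : Euc n → ℝ} (h : IsExtremalSubsolution α α {0}ᶜ u) (hb : BddAbove (u '' {0}ᶜ)) :
    ∃ c : ℝ, ∀ x ∈ ({0}ᶜ : Set (Euc n)), u x = c := by
  have : Nonempty (Fin n) := ⟨⟨0, by omega⟩⟩
  obtain ⟨x₁, hx₁, hmax⟩ := (h.1.mono (t := Metric.sphere 0 1) (by
    rintro w hw rfl
    simp at hw)).exists_isMaxOn (NormedSpace.sphere_nonempty.2 zero_le_one) (isCompact_sphere _ _)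
  have hsphere : ∀ x : Euc n, ‖x‖ = 1 → u x ≤ u x₁ := fun x hx =>
    isMaxOn_iff.1 hmax x (by simpa using hx)
  have hM : ∀ x : Euc n, x ≠ 0 → u x ≤ u x₁ := fun x hx =>
    (le_total ‖x‖ 1).elim (h.le_of_norm_le_one hn hα hb hsphere hx)
      (h.le_of_one_le_norm hα hb hsphere)
  have hx₁0 : x₁ ≠ 0 := by
    rintro rfl
    simp at hx₁
  refine ⟨u x₁, fun x hx => (hM x hx).eq_of_not_lt fun hlt => ?_⟩
  set V : Set (Euc n) := {w | w ≠ 0 ∧ u w < u x₁}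
  have hV : ∀ y ∈ V, ∀ w, ‖w - y‖ < ‖y‖ → w ∈ V := fun y hy w hw =>
    ⟨by
      rintro rfl
      simp at hw, h.lt_of_norm_sub_lt hα hM hy.2 hw⟩
  have hopen : IsOpen V := Metric.isOpen_iff.2 fun y hy =>
    ⟨‖y‖, norm_pos_iff.2 hy.1, fun w hw => hV y hy w (by simpa [dist_eq_norm] using hw)⟩
  have hconn : IsPreconnected ({0}ᶜ : Set (Euc n)) :=
    (isConnected_compl_singleton_of_one_lt_rank (by
      rw [← Module.finrank_eq_rank, finrank_euclideanSpace_fin]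
      exact_mod_cast hn) 0).isPreconnected
  -- The open set `V` is also relatively closed: a point of `V` within `‖w‖ / 2` of `w` has norm
  -- above `‖w‖ / 2`, so its ball of propagation contains `w`.
  have hsub := hconn.subset_of_closure_inter_subset hopen ⟨x, hx, hx, hlt⟩ (by
    rintro w ⟨hw, hw0⟩
    obtain ⟨y, hy, hwy⟩ := Metric.mem_closure_iff.1 hw (‖w‖ / 2) (half_pos (norm_pos_iff.2 hw0))
    rw [dist_eq_norm] at hwy
    refine hV y hy w ?_
    linarith [norm_sub_norm_le w y])
  exact lt_irrefl _ (hsub hx₁0).2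

/-- Equality makes `a j` half of the positive total weight, whereas for `n = 1` the complementary
weight is zero. -/
theorem two_le_and_pos_of_eq_complWeight {a : Fin n → ℝ} (ha : AdmissibleWeights a) {j : Fin n}
    (h : a j = complWeight a j) : 2 ≤ n ∧ 0 < a j := by
  obtain ⟨i, hi⟩ := ha.2
  have hpos : 0 < a j := by
    have : 0 < ∑ k, a k := Finset.sum_pos' (fun k _ => ha.1 k) ⟨i, Finset.mem_univ i, hi⟩
    rw [complWeight] at h
    linarith
  refine ⟨?_, hpos⟩
  by_contra! hlt
  obtain rfl : n = 1 := by
    have := j.2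
    omega
  rw [complWeight, Fin.sum_univ_one, Subsingleton.elim j 0, sub_self] at h
  rw [Subsingleton.elim j 0] at hpos
  linarith

end WeightedTrace

end

theorem mainTheorem12 (n : ℕ) (hn : 0 < n) (a : Fin n → ℝ)
    (ha : WeightedTrace.AdmissibleWeights a) :
    (a ⟨0, hn⟩ = WeightedTrace.complWeight a ⟨0, hn⟩ →
      ∀ u : WeightedTrace.Euc n → ℝ,
        WeightedTrace.IsViscositySubsolution (WeightedTrace.weightedTrace a) (fun _ => 0) {0}ᶜ u →
        BddAbove (u '' {0}ᶜ) →
        ∃ c : ℝ, ∀ x ∈ ({0}ᶜ : Set (WeightedTrace.Euc n)), u x = c) ∧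
    (WeightedTrace.complWeight a ⟨0, hn⟩ < a ⟨0, hn⟩ →
      ∀ u : WeightedTrace.Euc n → ℝ,
        WeightedTrace.IsViscositySubsolution (WeightedTrace.weightedTrace a) (fun _ => 0)
          Set.univ u →
        BddAbove (Set.range u) →
        ∃ c : ℝ, ∀ x, u x = c) ∧
    (a ⟨n - 1, Nat.sub_lt hn one_pos⟩
        = WeightedTrace.complWeight a ⟨n - 1, Nat.sub_lt hn one_pos⟩ →
      ∀ v : WeightedTrace.Euc n → ℝ,
        WeightedTrace.IsViscositySupersolution (WeightedTrace.weightedTrace a) (fun _ => 0)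
          {0}ᶜ v →
        BddBelow (v '' {0}ᶜ) →
        ∃ c : ℝ, ∀ x ∈ ({0}ᶜ : Set (WeightedTrace.Euc n)), v x = c) ∧
    (WeightedTrace.complWeight a ⟨n - 1, Nat.sub_lt hn one_pos⟩
        < a ⟨n - 1, Nat.sub_lt hn one_pos⟩ →
      ∀ v : WeightedTrace.Euc n → ℝ,
        WeightedTrace.IsViscositySupersolution (WeightedTrace.weightedTrace a) (fun _ => 0)
          Set.univ v →
        BddBelow (Set.range v) →
        ∃ c : ℝ, ∀ x, v x = c) := by
  have bdd_neg : ∀ {v : WeightedTrace.Euc n → ℝ} {s : Set (WeightedTrace.Euc n)},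
      BddBelow (v '' s) → BddAbove ((fun x => -v x) '' s) := by
    rintro v s ⟨B, hB⟩
    refine ⟨-B, ?_⟩
    rintro _ ⟨x, hx, rfl⟩
    exact neg_le_neg (hB ⟨x, hx, rfl⟩)
  refine ⟨fun h u hu hb => ?_, fun h u hu hb => ?_, fun h v hv hb => ?_, fun h v hv hb => ?_⟩
  · obtain ⟨h2, hpos⟩ := WeightedTrace.two_le_and_pos_of_eq_complWeight ha h
    have hu' := hu.isExtremalSubsolution hn ha.1
    rw [← h] at hu'
    exact hu'.exists_eq_const h2 hpos hb
  · have hle := (hu.isExtremalSubsolution hn ha.1).le_of_lt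
      (WeightedTrace.complWeight_nonneg ha.1 _) h hb
    exact ⟨u 0, fun x => le_antisymm (hle x 0) (hle 0 x)⟩
  · obtain ⟨h2, hpos⟩ := WeightedTrace.two_le_and_pos_of_eq_complWeight ha h
    have hv' := hv.isExtremalSubsolution_neg hn ha.1
    rw [← h] at hv'
    obtain ⟨c, hc⟩ := hv'.exists_eq_const h2 hpos (bdd_neg hb)
    exact ⟨-c, fun x hx => by rw [← hc x hx, neg_neg]⟩
  · rw [← Set.image_univ] at hb
    have hle := (hv.isExtremalSubsolution_neg hn ha.1).le_of_lt
      (WeightedTrace.complWeight_nonneg ha.1 _) h (by simpa only [Set.image_univ] using bdd_neg hb)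
    exact ⟨v 0, fun x => le_antisymm (neg_le_neg_iff.1 (hle 0 x)) (neg_le_neg_iff.1 (hle x 0))⟩
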